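/- **Setting.** Let $T>0$, $t_k=kT$. The plant state $x\in\mathbb R^n$ and the planner state $\bar x\in\mathbb R^n$ satisfy, between consecutive transition times, $$\dot x=f(x)+g(x)(u+v),\qquad \dot{\bar x}=A\bar x+Bv,\qquad t\in(t_k,t_{k+1}),$$ with $f,g$ locally Lipschitz, and for $k\ge 1$ the jumps $x^+(t_k)=\bar x^+(t_k)=\Delta(x^-(t_k))$, where $\Delta(x)=Dx+p$ is affine. Trajectories are right continuous at the $t_k$, and $\bar x(0)=x(0)$. The constraints are $$x(t)\in\mathcal X_c\ (t\ne t_k),\qquad x^+(t_k)\in\mathcal X_d\subseteq\mathcal X_c\ (k\ge 0),\qquad u(t)\in\mathcal U,\ v(t)\in\mathcal V\ (t\ge 0).$$ Let $h_x,h_e:\mathbb R^n\to\mathbb R$ be continuously differentiable, $\mathcal S_x=\{h_x\ge0\}\subseteq\mathcal X_c$, $\mathcal S_e=\{h_e\ge 0\}\ni 0$, with $\nabla h_x\neq0$ on $\partial\mathcal S_x$ and $\nabla h_e\ne0$ on $\partial\mathcal S_e$. Write $\boldsymbol z=(x,\bar x)$, $F(\boldsymbol z,u,v)=(f(x)+g(x)(u+v),\,A\bar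 x+Bv)$, $V(\boldsymbol z)=(x-\bar x)^\top Q_v(x-\bar x)$ and $\mathcal I=\{\boldsymbol z: x\in\mathcal S_x,\ x-\bar x\in\mathcal S_e\}$. **Low level policy.** Let $c_1,c_2>0$ and let $\alpha_1,\alpha_2:\mathbb R\to\mathbb R$ be strictly increasing and vanish at $0$. Wherever the quadratic program $$\min_{u\in\mathcal U,\ \gamma\in\mathbb R}\ \|u\|^2+c_1\gamma^2\quad\text{s.t.}\quad \tfrac{\partial V}{\partial\boldsymbol z}F\le -c_2V+\gamma,\quad \tfrac{\partial h_x}{\partial x}\big(f+g(u+v)\big)\ge-\alpha_1(h_x),\quad \tfrac{\partial h_e(x-\bar x)}{\partial\boldsymbol z}F\ge-\alpha_2(h_e(x-\bar x))$$ is feasible, $\pi^u(\boldsymbol z,v)$ is the input $u$ of an optimal solution. Assume that the program is feasible for all $\boldsymbol z\in\mathcal I$ and $v\in\mathcal V$, and that for each $v\in\mathcal V$ the map $\pi^u(\cdot,v)$ is Lipschitz on a neighborhood of each point of $\mathcal I$. **High level policy.** Let $\bar A=e^{AT}$, $\bar B=\int_0^Te^{A(T-\eta)}B\,d\eta$, let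 $K$ be a feedback gain, $\bar{\mathcal S}_e\supseteq\mathcal S_e$, $\mathcal W=\Delta(\bar{\mathcal S}_e)$, $\mathcal E_0=\{0\}$, $\mathcal E_{j+1}=D(\bar A+\bar BK)\mathcal E_j\oplus\mathcal W$. For a horizon $N\ge1$ and a state $x_0$, consider the problem of minimizing $$\sum_{j=0}^N\big(\|x_j-x_g\|_Q+\|v_j\|_R\big)+\|x_N-x_g\|_{Q_f},\qquad \|y\|_Q=y^\top Qy,$$ subject to: the initial state $x_0$ is the given one; $x_{j+1}=D(\bar A+\bar BK)x_j+D\bar Bv_j$ for $0\le j<N$; $x_j\in(\mathcal X_d\cap\mathcal S_x)\ominus\mathcal E_j$ and $v_j+Kx_j\in\mathcal V\ominus K\mathcal E_j$ for $0\le j\le N$; and $x_N\in\mathcal X_F\ominus\mathcal E_N$. Here $\oplus$ and $\ominus$ are the Minkowski sum and the Pontryagin difference. Wherever this problem is feasible, $\pi^v(x_0)=v_0^*+Kx_0$ for an optimal solution $(x_j^*,v_j^*)$. Assume that the terminal set is admissible, $\mathcal X_F\subseteq\mathcal X_d\cap\mathcal S_x$ and $K\mathcal X_F\subseteq\mathcal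 V$, and robustly positively invariant: $D(\bar A+\bar BK)x+w\in\mathcal X_F$ for all $x\in\mathcal X_F$, $w\in\mathcal W$. **Closed loop.** $u(t)=\pi^u(x(t),\bar x(t),v(t))$ for $t\in(t_k,t_{k+1})$ and for $t=0$; $u(t_k)=u^-(t_k)$ for $k\ge1$; and $v(t)=\pi^v(x^+(t_k))$ for $t\in[t_k,t_{k+1})$. **Theorem.** If the optimal control problem is feasible at $t=0$, that is, for $x_0=x(0)$, then every closed-loop trajectory satisfies the state and input constraints above for all $t\ge0$ (and a trajectory that exists only on $[0,\tau)$ satisfies them for all $t\in[0,\tau)$). -/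

import Mathlib

open Set Filter Topology
open scoped Pointwise

/-- Data of the two-layer control architecture: `n` is the state dimension, `d` the input
dimension. Matrices are linear maps between Euclidean spaces. This structure carries no
hypotheses. -/
structure MultiRate (n d : ℕ) where
  /-- period of the high level updates: the discontinuous transitions occur at `k * T` -/
  T : ℝ
  /-- drift of the plant -/
  f : EuclideanSpace ℝ (Fin n) → EuclideanSpace ℝ (Fin n)
  /-- input matrix of the plant -/
  g : EuclideanSpace ℝ (Fin n) → (EuclideanSpace ℝ (Fin d) →L[ℝ] EuclideanSpace ℝ (Fin n))
  /-- linear part of the affine reset map -/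
  D : EuclideanSpace ℝ (Fin n) →L[ℝ] EuclideanSpace ℝ (Fin n)
  /-- offset of the affine reset map -/
  p : EuclideanSpace ℝ (Fin n)
  /-- state matrix of the linear planning model -/
  A : EuclideanSpace ℝ (Fin n) →L[ℝ] EuclideanSpace ℝ (Fin n)
  /-- input matrix of the linear planning model -/
  B : EuclideanSpace ℝ (Fin d) →L[ℝ] EuclideanSpace ℝ (Fin n)
  /-- continuous-time state constraint set -/
  Xc : Set (EuclideanSpace ℝ (Fin n))
  /-- state constraint set at the discontinuous transitions -/
  Xd : Set (EuclideanSpace ℝ (Fin n))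
  /-- constraint set of the low level input -/
  U : Set (EuclideanSpace ℝ (Fin d))
  /-- constraint set of the high level input -/
  V : Set (EuclideanSpace ℝ (Fin d))
  /-- barrier function of the state -/
  hx : EuclideanSpace ℝ (Fin n) → ℝ
  /-- barrier function of the tracking error -/
  he : EuclideanSpace ℝ (Fin n) → ℝ
  /-- gain of the barrier condition for `hx` -/
  α₁ : ℝ → ℝ
  /-- gain of the barrier condition for `he` -/
  α₂ : ℝ → ℝ
  /-- weight of the Lyapunov function -/
  Qv : EuclideanSpace ℝ (Fin n) →L[ℝ] EuclideanSpace ℝ (Fin n)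
  /-- weight of the slack variable -/
  c₁ : ℝ
  /-- decay rate in the Lyapunov condition -/
  c₂ : ℝ
  /-- outer approximation of the error set -/
  SeBar : Set (EuclideanSpace ℝ (Fin n))
  /-- prediction horizon -/
  N : ℕ
  /-- feedback gain of the tube -/
  K : EuclideanSpace ℝ (Fin n) →L[ℝ] EuclideanSpace ℝ (Fin d)
  /-- terminal set -/
  XF : Set (EuclideanSpace ℝ (Fin n))
  /-- goal state -/
  xg : EuclideanSpace ℝ (Fin n)
  /-- stage weight of the state -/
  Q : EuclideanSpace ℝ (Fin n) →L[ℝ] EuclideanSpace ℝ (Fin n)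
  /-- stage weight of the input -/
  R : EuclideanSpace ℝ (Fin d) →L[ℝ] EuclideanSpace ℝ (Fin d)
  /-- terminal weight -/
  Qf : EuclideanSpace ℝ (Fin n) →L[ℝ] EuclideanSpace ℝ (Fin n)

/-- Extended class-`𝓚` functions: strictly increasing, zero at zero. -/
structure IsExtendedClassK (α : ℝ → ℝ) : Prop where
  strictMono : StrictMono α
  map_zero : α 0 = 0

/-- Pontryagin difference `P ⊖ S`. -/
def pontryaginDiff {E : Type*} [Add E] (P S : Set E) : Set E :=
  {x | ∀ s ∈ S, x + s ∈ P}

namespace MultiRate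

variable {n d : ℕ} (S : MultiRate n d)

/-- The affine reset map `Δ`. -/
def reset (x : EuclideanSpace ℝ (Fin n)) : EuclideanSpace ℝ (Fin n) := S.D x + S.p

/-- The safe set `S_x = {h_x ≥ 0}`. -/
def Sx : Set (EuclideanSpace ℝ (Fin n)) := {x | 0 ≤ S.hx x}

/-- The error set `S_e = {h_e ≥ 0}`. -/
def Se : Set (EuclideanSpace ℝ (Fin n)) := {e | 0 ≤ S.he e}

/-- The set `I` of pairs `(x, x̄)` with `x ∈ S_x` and `x - x̄ ∈ S_e`. -/
def safePairs : Set (EuclideanSpace ℝ (Fin n) × EuclideanSpace ℝ (Fin n)) :=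
  {z | z.1 ∈ S.Sx ∧ z.1 - z.2 ∈ S.Se}

/-- Right-hand side of the augmented continuous dynamics:
`ẋ = f(x) + g(x)(u + v)` and `x̄' = A x̄ + B v`. -/
def augField (z : EuclideanSpace ℝ (Fin n) × EuclideanSpace ℝ (Fin n))
    (u v : EuclideanSpace ℝ (Fin d)) :
    EuclideanSpace ℝ (Fin n) × EuclideanSpace ℝ (Fin n) :=
  (S.f z.1 + S.g z.1 (u + v), S.A z.2 + S.B v)

/-! ### Low level: the CLF-CBF quadratic program -/

/-- Candidate Lyapunov function `(x - x̄)ᵀ Q_v (x - x̄)`. -/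
noncomputable def clf (z : EuclideanSpace ℝ (Fin n) × EuclideanSpace ℝ (Fin n)) : ℝ :=
  inner ℝ (z.1 - z.2) (S.Qv (z.1 - z.2))

/-- `(u, γ)` satisfies the constraints of the quadratic program at `z = (x, x̄)` and `v`. -/
structure QPFeasible (z : EuclideanSpace ℝ (Fin n) × EuclideanSpace ℝ (Fin n))
    (v u : EuclideanSpace ℝ (Fin d)) (γ : ℝ) : Prop where
  input : u ∈ S.U
  lyapunov : fderiv ℝ S.clf z (S.augField z u v) ≤ -S.c₂ * S.clf z + γ
  state_barrier : -S.α₁ (S.hx z.1) ≤ fderiv ℝ S.hx z.1 (S.f z.1 + S.g z.1 (u + v))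
  error_barrier : -S.α₂ (S.he (z.1 - z.2)) ≤
    fderiv ℝ (fun y : EuclideanSpace ℝ (Fin n) × EuclideanSpace ℝ (Fin n) => S.he (y.1 - y.2)) z
      (S.augField z u v)

/-- Objective of the quadratic program. -/
noncomputable def qpCost (u : EuclideanSpace ℝ (Fin d)) (γ : ℝ) : ℝ := ‖u‖ ^ 2 + S.c₁ * γ ^ 2

/-- `(u, γ)` is an optimal solution of the quadratic program at `z = (x, x̄)` and `v`. -/
def QPOptimal (z : EuclideanSpace ℝ (Fin n) × EuclideanSpace ℝ (Fin n))
    (v u : EuclideanSpace ℝ (Fin d)) (γ : ℝ) : Prop :=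
  S.QPFeasible z v u γ ∧ ∀ u' γ', S.QPFeasible z v u' γ' → S.qpCost u γ ≤ S.qpCost u' γ'

/-- `πu` is the low level policy: where the quadratic program is feasible, `πu` returns the input
of an optimal solution. Nothing is required where it is infeasible. -/
def IsLowLevelPolicy
    (πu : EuclideanSpace ℝ (Fin n) × EuclideanSpace ℝ (Fin n) → EuclideanSpace ℝ (Fin d) →
      EuclideanSpace ℝ (Fin d)) : Prop :=
  ∀ z v, (∃ u γ, S.QPFeasible z v u γ) → ∃ γ, S.QPOptimal z v (πu z v) γ

/-! ### High level: robust tube model predictive control -/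

/-- `Ā = exp(A T)`. -/
noncomputable def Abar : EuclideanSpace ℝ (Fin n) →L[ℝ] EuclideanSpace ℝ (Fin n) :=
  NormedSpace.exp (S.T • S.A)

/-- `B̄ = ∫₀ᵀ exp(A (T - η)) B dη`. -/
noncomputable def Bbar : EuclideanSpace ℝ (Fin d) →L[ℝ] EuclideanSpace ℝ (Fin n) :=
  ∫ η in (0 : ℝ)..S.T, (NormedSpace.exp ((S.T - η) • S.A)).comp S.B

/-- Closed-loop matrix of the sampled nominal model under the gain `K`: the linear part of the
reset map, composed with `Ā + B̄ K`. -/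
noncomputable def Acl : EuclideanSpace ℝ (Fin n) →L[ℝ] EuclideanSpace ℝ (Fin n) :=
  S.D.comp (S.Abar + S.Bbar.comp S.K)

/-- The disturbance set `Δ(S̄_e)`. -/
def W : Set (EuclideanSpace ℝ (Fin n)) := S.reset '' S.SeBar

/-- Cross sections of the tube, indexed by the prediction step. -/
noncomputable def tube : ℕ → Set (EuclideanSpace ℝ (Fin n))
  | 0 => {0}
  | j + 1 => S.Acl '' tube j + S.W

/-- The predicted states `xs 0, …, xs N` and decision variables `vs 0, …, vs N` satisfy the
constraints of the finite time optimal control problem with initial state `x₀`. Prediction step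
`j` is `j` periods ahead of the current time. The entries of the sequences beyond `N` play no
role. -/
structure OCPFeasible (x₀ : EuclideanSpace ℝ (Fin n)) (xs : ℕ → EuclideanSpace ℝ (Fin n))
    (vs : ℕ → EuclideanSpace ℝ (Fin d)) : Prop where
  init : xs 0 = x₀
  dyn : ∀ j < S.N, xs (j + 1) = S.Acl (xs j) + S.D (S.Bbar (vs j))
  state : ∀ j ≤ S.N, xs j ∈ pontryaginDiff (S.Xd ∩ S.Sx) (S.tube j)
  input : ∀ j ≤ S.N, vs j + S.K (xs j) ∈ pontryaginDiff S.V (S.K '' S.tube j)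
  terminal : xs S.N ∈ pontryaginDiff S.XF (S.tube S.N)

/-- Objective of the finite time optimal control problem. -/
noncomputable def ocpCost (xs : ℕ → EuclideanSpace ℝ (Fin n))
    (vs : ℕ → EuclideanSpace ℝ (Fin d)) : ℝ :=
  (∑ j ∈ Finset.range (S.N + 1),
    (inner ℝ (xs j - S.xg) (S.Q (xs j - S.xg)) + inner ℝ (vs j) (S.R (vs j)))) +
  inner ℝ (xs S.N - S.xg) (S.Qf (xs S.N - S.xg))

/-- Optimal solutions of the finite time optimal control problem. -/
def OCPOptimal (x₀ : EuclideanSpace ℝ (Fin n)) (xs : ℕ → EuclideanSpace ℝ (Fin n))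
    (vs : ℕ → EuclideanSpace ℝ (Fin d)) : Prop :=
  S.OCPFeasible x₀ xs vs ∧
    ∀ xs' vs', S.OCPFeasible x₀ xs' vs' → S.ocpCost xs vs ≤ S.ocpCost xs' vs'

/-- `πv` is the high level policy: where the finite time optimal control problem is feasible, it
returns `v₀ + K x₀` for an optimal solution. Nothing is required where it is infeasible. -/
def IsHighLevelPolicy (πv : EuclideanSpace ℝ (Fin n) → EuclideanSpace ℝ (Fin d)) : Prop :=
  ∀ x₀, (∃ xs vs, S.OCPFeasible x₀ xs vs) →
    ∃ xs vs, S.OCPOptimal x₀ xs vs ∧ πv x₀ = vs 0 + S.K (xs 0)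

/-- `X` is robust positively invariant for `x(k+1) = D (Ā + B̄ K) x(k) + w(k)` with
`w(k) ∈ Δ(S̄_e)`. -/
def IsRobustPosInvariant (X : Set (EuclideanSpace ℝ (Fin n))) : Prop :=
  ∀ x ∈ X, ∀ w ∈ S.W, S.Acl x + w ∈ X

/-! ### Closed loop -/

/-- `(x, xb, u, v)` is a trajectory on `[0, τ)` of the augmented system in closed loop with the
policies `πu` and `πv`. The states `x` and `xb` are right continuous at the transition times
`k * T`, so that `x⁺ = x (k * T)` and `x̄⁺ = xb (k * T)`. -/
structure IsClosedLoop
    (πu : EuclideanSpace ℝ (Fin n) × EuclideanSpace ℝ (Fin n) → EuclideanSpace ℝ (Fin d) →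
      EuclideanSpace ℝ (Fin d))
    (πv : EuclideanSpace ℝ (Fin n) → EuclideanSpace ℝ (Fin d)) (τ : EReal)
    (x xb : ℝ → EuclideanSpace ℝ (Fin n)) (u v : ℝ → EuclideanSpace ℝ (Fin d)) : Prop where
  /-- between transitions the augmented state follows the continuous dynamics -/
  flow : ∀ (k : ℕ) (t : ℝ), k * S.T < t → t < (k + 1) * S.T → (t : EReal) < τ →
    HasDerivAt (fun s => (x s, xb s)) (S.augField (x t, xb t) (u t) (v t)) t
  /-- between transitions `u` is given by the low level policy -/
  low : ∀ (k : ℕ) (t : ℝ), k * S.T < t → t < (k + 1) * S.T → (t : EReal) < τ →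
    u t = πu (x t, xb t) (v t)
  /-- `v⁺ = πv(x⁺)` at the transitions, and `v` is constant until the next one -/
  high : ∀ (k : ℕ) (t : ℝ), k * S.T ≤ t → t < (k + 1) * S.T → (t : EReal) < τ →
    v t = πv (x (k * S.T))
  right_x : ∀ k : ℕ, ((k * S.T : ℝ) : EReal) < τ →
    Tendsto x (𝓝[>] (k * S.T)) (𝓝 (x (k * S.T)))
  right_xb : ∀ k : ℕ, ((k * S.T : ℝ) : EReal) < τ →
    Tendsto xb (𝓝[>] (k * S.T)) (𝓝 (xb (k * S.T)))
  /-- the left limit `x⁻` exists at the transitions, the plant jumps to `x⁺ = Δ(x⁻)`, and the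
  planner state is reset to the same value, `x̄⁺ = Δ(x⁻)` -/
  jump : ∀ k : ℕ, 1 ≤ k → ((k * S.T : ℝ) : EReal) < τ →
    ∃ xm, Tendsto x (𝓝[<] (k * S.T)) (𝓝 xm) ∧
      x (k * S.T) = S.reset xm ∧ xb (k * S.T) = S.reset xm
  /-- at the transitions `u` keeps its left limit, `u⁺ = u⁻` -/
  jump_u : ∀ k : ℕ, 1 ≤ k → ((k * S.T : ℝ) : EReal) < τ →
    Tendsto u (𝓝[<] (k * S.T)) (𝓝 (u (k * S.T)))
  /-- the planner starts at the state of the plant -/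
  init_xb : xb 0 = x 0
  /-- the first input is given by the low level policy -/
  init_u : u 0 = πu (x 0, xb 0) (v 0)

end MultiRate

/-!
At a boundary point of `I = S.safePairs`, the barrier constraints of the quadratic program make
the closed-loop vector field a Bouligand tangent vector of `I`: moving it slightly along the
nonzero gradients gives vectors that point into `I`, and the tangent cone is closed. By Nagumo's
theorem `I` is therefore forward invariant on each period, on which `v` is constant. At the end of
a period the planner state has moved to `Ā x + B̄ v`, by variation of constants, and the reset,
being affine, turns the tracking error into a disturbance in `W`. A prediction that is feasible
for the old sampled state is prolonged by one step with the terminal controller, and then shifted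
and corrected by the propagated disturbance; the tubes absorb the correction, so the new sampled
state is feasible.
-/

/-! ### Functions that are Lipschitz near a point -/

/-- `f` is Lipschitz on some neighbourhood of `x`, the pointwise form of `LocallyLipschitz f`. -/
def LipschitzNear {X Y : Type*} [PseudoEMetricSpace X] [PseudoEMetricSpace Y] (f : X → Y)
    (x : X) : Prop :=
  ∃ L : NNReal, ∃ s ∈ 𝓝 x, LipschitzOnWith L f s

namespace LipschitzNear

variable {X Y Z : Type*} [PseudoEMetricSpace X] [PseudoEMetricSpace Y] [PseudoEMetricSpace Z]
  {f : X → Y} {x : X}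

theorem continuousAt (hf : LipschitzNear f x) : ContinuousAt f x := by
  obtain ⟨L, s, hs, hL⟩ := hf
  exact hL.continuousOn.continuousAt hs

theorem prodMk {g : X → Z} (hf : LipschitzNear f x) (hg : LipschitzNear g x) :
    LipschitzNear (fun y => (f y, g y)) x := by
  obtain ⟨L, s, hs, hL⟩ := hf
  obtain ⟨M, t, ht, hM⟩ := hg
  exact ⟨max L M, s ∩ t, inter_mem hs ht,
    (hL.mono inter_subset_left).prodMk (hM.mono inter_subset_right)⟩

theorem comp {g : Y → Z} (hg : LipschitzNear g (f x)) (hf : LipschitzNear f x) :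
    LipschitzNear (g ∘ f) x := by
  obtain ⟨M, t, ht, hM⟩ := hg
  obtain ⟨L, s, hs, hL⟩ := id hf
  exact ⟨M * L, s ∩ f ⁻¹' t, inter_mem hs (hf.continuousAt.preimage_mem_nhds ht),
    hM.comp (hL.mono inter_subset_left) fun _ hy => hy.2⟩

section NormedSpace

variable {E F : Type*} [NormedAddCommGroup E] [NormedSpace ℝ E] [NormedAddCommGroup F]
  [NormedSpace ℝ F]

theorem add {f g : X → F} (hf : LipschitzNear f x) (hg : LipschitzNear g x) :
    LipschitzNear (fun y => f y + g y) x :=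
  have hadd : ContDiff ℝ 1 fun p : F × F => p.1 + p.2 := contDiff_fst.add contDiff_snd
  comp (g := fun p : F × F => p.1 + p.2) (hadd.locallyLipschitz _) (hf.prodMk hg)

theorem clm_apply {g : X → E →L[ℝ] F} {μ : X → E} (hg : LipschitzNear g x)
    (hμ : LipschitzNear μ x) : LipschitzNear (fun y => g y (μ y)) x :=
  have happly : ContDiff ℝ 1 fun p : (E →L[ℝ] F) × E => p.1 p.2 :=
    contDiff_fst.clm_apply contDiff_snd
  comp (g := fun p : (E →L[ℝ] F) × E => p.1 p.2) (happly.locallyLipschitz _) (hg.prodMk hμ)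

end NormedSpace

end LipschitzNear

/-! ### Bouligand tangent vectors and Nagumo's theorem -/

section TangentCone

variable {E : Type*} [NormedAddCommGroup E] [NormedSpace ℝ E] {s : Set E} {x v : E}

theorem isClosed_posTangentConeAt : IsClosed (posTangentConeAt s x) := by
  rw [posTangentConeAt, tangentConeAt_eq_biInter_closure]
  exact isClosed_biInter fun _ _ => isClosed_closure

theorem mem_posTangentConeAt_of_forall_perturbation (p : E)
    (h : ∀ ε > (0 : ℝ), ∃ᶠ δ in 𝓝[>] (0 : ℝ), x + δ • (v + ε • p) ∈ s) :
    v ∈ posTangentConeAt s x := by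
  have hlim : Tendsto (fun ε : ℝ => v + ε • p) (𝓝[>] 0) (𝓝 v) := by
    have hc : Continuous fun ε : ℝ => v + ε • p := by fun_prop
    simpa using (hc.tendsto 0).mono_left nhdsWithin_le_nhds
  refine isClosed_posTangentConeAt.mem_of_tendsto hlim ?_
  filter_upwards [self_mem_nhdsWithin] with ε hε
  exact mem_posTangentConeAt_of_frequently_mem (h ε hε)

theorem frequently_infDist_add_smul_le (hv : v ∈ posTangentConeAt s x) {ε : ℝ} (hε : 0 < ε) :
    ∃ᶠ δ in 𝓝[>] (0 : ℝ), Metric.infDist (x + δ • v) s ≤ ε * δ := by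
  rcases eq_or_ne v 0 with rfl | hv0
  · have hx : x ∈ closure s := mem_closure_of_nonempty_tangentConeAt ⟨_, hv⟩
    refine Eventually.frequently ?_
    filter_upwards [self_mem_nhdsWithin] with δ hδ
    rw [smul_zero, add_zero, Metric.infDist_zero_of_mem_closure hx]
    exact (mul_pos hε hδ).le
  obtain ⟨α, l, _, c, d, hd, hds, hcd⟩ := exists_fun_of_mem_tangentConeAt hv
  have hcd0 : ∀ᶠ i in l, c i • d i ≠ 0 := hcd.eventually_ne hv0
  have hscale : Tendsto (fun i => (c i : ℝ)⁻¹) l (𝓝[>] 0) := by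
    refine tendsto_nhdsWithin_iff.2 ⟨?_, ?_⟩
    · have hquot := hd.norm.div hcd.norm (norm_ne_zero_iff.2 hv0)
      rw [norm_zero, zero_div] at hquot
      refine hquot.congr' ?_
      filter_upwards [hcd0] with i hi
      have hdi : ‖d i‖ ≠ 0 := norm_ne_zero_iff.2 (right_ne_zero_of_smul hi)
      rw [Pi.div_apply, NNReal.smul_def, norm_smul, NNReal.norm_eq, div_mul_cancel_right₀ hdi]
    · filter_upwards [hcd0] with i hi
      exact inv_pos.2 (NNReal.coe_pos.2 (pos_of_ne_zero (left_ne_zero_of_smul hi)))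
  refine hscale.frequently (Eventually.frequently ?_)
  filter_upwards [hds, hcd0, hcd.eventually (Metric.ball_mem_nhds v hε)] with i hmem hi hball
  have hci : (c i : ℝ) ≠ 0 := NNReal.coe_ne_zero.2 (left_ne_zero_of_smul hi)
  have hdiff : x + (c i : ℝ)⁻¹ • v - (x + d i) = -((c i : ℝ)⁻¹ • (c i • d i - v)) := by
    rw [NNReal.smul_def, smul_sub, inv_smul_smul₀ hci]
    abel
  calc Metric.infDist (x + (c i : ℝ)⁻¹ • v) s
      ≤ dist (x + (c i : ℝ)⁻¹ • v) (x + d i) := Metric.infDist_le_dist_of_mem hmem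
    _ = (c i : ℝ)⁻¹ * dist (c i • d i) v := by
        rw [dist_eq_norm, hdiff, norm_neg, norm_smul, norm_inv, NNReal.norm_eq, dist_eq_norm]
    _ ≤ ε * (c i : ℝ)⁻¹ := by
        rw [mul_comm ε]
        gcongr

end TangentCone

section Nagumo

variable {E : Type*} [NormedAddCommGroup E] [NormedSpace ℝ E] {s u : Set E} {G : E → E}
  {z : ℝ → E} {L : NNReal} {a b : ℝ}

theorem isIntegralCurveOn_Ico_of_continuousWithinAt (ha : ContinuousWithinAt z (Ioi a) a)
    (hG : ContinuousAt G (z a)) (hz : ∀ t ∈ Ioo a b, HasDerivAt z (G (z t)) t) :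
    IsIntegralCurveOn z (fun _ => G) (Ico a b) := by
  intro t ht
  rcases eq_or_lt_of_le ht.1 with rfl | hat
  · have hmem : Ioo a b ∈ 𝓝[>] a := Ioo_mem_nhdsGT ht.2
    refine (hasDerivWithinAt_Ici_of_tendsto_deriv (s := Ioo a b) ?_ (ha.mono Ioo_subset_Ioi_self)
      hmem ?_).mono Ico_subset_Ici_self
    · exact fun r hr => (hz r hr).differentiableAt.differentiableWithinAt
    · refine (hG.tendsto.comp ha).congr' ?_
      filter_upwards [hmem] with r hr using (hz r hr).deriv.symm
  · exact (hz t ⟨hat, ht.2⟩).hasDerivWithinAt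

/-- Compare `z` with the straight line that leaves a nearest point `y` in the direction `G y`. -/
theorem frequently_slope_infDist_lt {t r : ℝ} {y : E} (hG : LipschitzOnWith L G u)
    (hzu : z t ∈ u) (hyu : y ∈ u) (hy : Metric.infDist (z t) s = dist (z t) y)
    (htan : G y ∈ posTangentConeAt s y) (hz : HasDerivWithinAt z (G (z t)) (Ici t) t)
    (hr : L * Metric.infDist (z t) s < r) :
    ∃ᶠ t' in 𝓝[>] t, (t' - t)⁻¹ * (Metric.infDist (z t') s - Metric.infDist (z t) s) < r := by
  obtain ⟨ε, hε, hεr⟩ : ∃ ε > 0, L * Metric.infDist (z t) s + 2 * ε < r :=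
    ⟨(r - L * Metric.infDist (z t) s) / 3, by linarith, by linarith⟩
  have htaylor : ∀ᶠ t' in 𝓝[>] t, ‖z t' - z t - (t' - t) • G (z t)‖ ≤ ε * ‖t' - t‖ :=
    nhdsWithin_mono _ Ioi_subset_Ici_self ((hasDerivWithinAt_iff_isLittleO.1 hz).def hε)
  have hshift : map (t + ·) (𝓝[>] (0 : ℝ)) = 𝓝[>] t := by
    simpa only [add_zero] using map_add_left_nhdsGT (c := t) (a := (0 : ℝ))
  rw [← hshift] at htaylor ⊢
  refine (((frequently_infDist_add_smul_le htan hε).and_eventually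
    (eventually_map.1 htaylor)).and_eventually self_mem_nhdsWithin).mono ?_
  rintro δ ⟨⟨hline, hδtaylor⟩, hδ : 0 < δ⟩
  rw [add_sub_cancel_left, Real.norm_of_nonneg hδ.le] at hδtaylor
  have hlip : ‖G (z t) - G y‖ ≤ L * ‖z t - y‖ := hG.norm_sub_le hzu hyu
  have hdist : dist (z (t + δ)) (y + δ • G y) ≤
      ε * δ + ‖z t - y‖ + δ * (L * ‖z t - y‖) := by
    have hsplit : z (t + δ) - (y + δ • G y) =
        (z (t + δ) - z t - δ • G (z t)) + (z t - y) + δ • (G (z t) - G y) := by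
      module
    rw [dist_eq_norm, hsplit]
    refine norm_add₃_le.trans ?_
    rw [norm_smul, Real.norm_of_nonneg hδ.le]
    gcongr
  have htriangle := Metric.infDist_le_infDist_add_dist (s := s) (x := z (t + δ)) (y := y + δ • G y)
  rw [add_sub_cancel_left, inv_mul_lt_iff₀ hδ]
  rw [dist_eq_norm] at hy
  rw [hy] at hεr ⊢
  nlinarith

variable [ProperSpace E]

theorem mapsTo_of_mem_posTangentConeAt_of_mapsTo_ball {x : E} {ρ : ℝ} (hs : IsClosed s)
    (hx : x ∈ s) (hG : LipschitzOnWith L G (Metric.ball x ρ))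
    (htan : ∀ y ∈ s, G y ∈ posTangentConeAt s y)
    (hz : IsIntegralCurveOn z (fun _ => G) (Icc a b))
    (hball : MapsTo z (Ico a b) (Metric.ball x (ρ / 2))) (ha : z a ∈ s) :
    MapsTo z (Icc a b) s := by
  have hbound : ∀ t ∈ Icc a b, Metric.infDist (z t) s ≤ gronwallBound 0 L 0 (t - a) := by
    refine le_gronwallBound_of_liminf_deriv_right_le (f' := fun t => L * Metric.infDist (z t) s)
      ((Metric.continuous_infDist_pt s).comp_continuousOn hz.continuousOn) (fun t ht r hr => ?_)
      (Metric.infDist_zero_of_mem ha).le fun t _ => (add_zero _).ge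
    obtain ⟨y, hys, hy⟩ := hs.exists_infDist_eq_dist ⟨x, hx⟩ (z t)
    have hzx : dist (z t) x < ρ / 2 := hball ht
    have hzy : dist (z t) y < ρ / 2 := hy ▸ (Metric.infDist_le_dist_of_mem hx).trans_lt hzx
    have hyx : dist y x < ρ := by linarith [dist_triangle_left y x (z t)]
    have hzx' : dist (z t) x < ρ := by linarith [dist_nonneg (x := z t) (y := x)]
    exact frequently_slope_infDist_lt hG hzx' hyx hy (htan y hys)
      ((hz t (Ico_subset_Icc_self ht)).mono_of_mem_nhdsWithin (Icc_mem_nhdsGE_of_mem ht)) hr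
  intro t ht
  have hle := hbound t ht
  rw [gronwallBound_ε0_δ0] at hle
  exact (hs.mem_iff_infDist_zero ⟨x, hx⟩).2 (hle.antisymm Metric.infDist_nonneg)

theorem mapsTo_of_mem_posTangentConeAt (hs : IsClosed s)
    (hG : ∀ y ∈ s, LipschitzNear G y) (htan : ∀ y ∈ s, G y ∈ posTangentConeAt s y)
    (hz : IsIntegralCurveOn z (fun _ => G) (Icc a b)) (ha : z a ∈ s) :
    MapsTo z (Icc a b) s := by
  have hclosed : IsClosed (z ⁻¹' s ∩ Icc a b) := by
    rw [inter_comm]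
    exact hz.continuousOn.preimage_isClosed_of_isClosed isClosed_Icc hs
  refine hclosed.Icc_subset_of_forall_mem_nhdsWithin ha ?_
  rintro t₀ ⟨ht₀s, ht₀⟩
  obtain ⟨L, u, hu, hL⟩ := hG _ ht₀s
  obtain ⟨ρ, hρ, hρu⟩ := Metric.mem_nhds_iff.1 hu
  have hcont : ContinuousWithinAt z (Ici t₀) t₀ :=
    (hz.continuousOn t₀ (Ico_subset_Icc_self ht₀)).mono_of_mem_nhdsWithin
      (Icc_mem_nhdsGE_of_mem ht₀)
  obtain ⟨c, hc, hball⟩ := mem_nhdsGE_iff_exists_Icc_subset.1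
    (inter_mem (hcont (Metric.ball_mem_nhds (z t₀) (half_pos hρ))) (Icc_mem_nhdsGE ht₀.2))
  filter_upwards [Icc_mem_nhdsGT hc] with t ht
  exact mapsTo_of_mem_posTangentConeAt_of_mapsTo_ball hs ht₀s (hL.mono hρu) htan
    (hz.mono fun r hr => ⟨ht₀.1.trans hr.1, (hball hr).2.2⟩)
    (fun r hr => (hball (Ico_subset_Icc_self hr)).1) ht₀s ht

end Nagumo

/-! ### Superlevel sets of differentiable functions -/

section Superlevel

variable {E : Type*} [NormedAddCommGroup E] [NormedSpace ℝ E] {h : E → ℝ} {y w : E}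

theorem eventually_nonneg_add_smul_of_fderiv_pos (hd : DifferentiableAt ℝ h y) (hy : 0 ≤ h y)
    (hw : h y = 0 → 0 < fderiv ℝ h y w) : ∀ᶠ δ in 𝓝[>] (0 : ℝ), 0 ≤ h (y + δ • w) := by
  have hline : HasLineDerivAt ℝ h (fderiv ℝ h y w) y w := hd.hasFDerivAt.hasLineDerivAt w
  rcases eq_or_lt_of_le hy with h0 | hpos
  · filter_upwards [hline.tendsto_slope_zero_right.eventually (lt_mem_nhds (hw h0.symm)),
      self_mem_nhdsWithin] with δ hδ hδ0
    rw [← h0, sub_zero, smul_eq_mul] at hδ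
    exact (pos_of_mul_pos_right hδ (inv_pos.2 hδ0).le).le
  · have hcont : ContinuousAt (fun δ : ℝ => h (y + δ • w)) 0 := HasDerivAt.continuousAt hline
    have hpos' : 0 < h (y + (0 : ℝ) • w) := by rwa [zero_smul, add_zero]
    exact ((hcont.eventually (lt_mem_nhds hpos')).filter_mono nhdsWithin_le_nhds).mono
      fun _ => le_of_lt

theorem exists_forall_eventually_nonneg_add_smul (hd : DifferentiableAt ℝ h y) (hy : 0 ≤ h y)
    (hw : h y = 0 → 0 ≤ fderiv ℝ h y w)
    (hreg : y ∈ frontier {x | 0 ≤ h x} → fderiv ℝ h y ≠ 0) :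
    ∃ q : E, ∀ ε > (0 : ℝ), ∀ᶠ δ in 𝓝[>] (0 : ℝ), 0 ≤ h (y + δ • (w + ε • q)) := by
  by_cases hint : {x | 0 ≤ h x} ∈ 𝓝 y
  · refine ⟨0, fun ε _ => ?_⟩
    have hline : Tendsto (fun δ : ℝ => y + δ • (w + ε • (0 : E))) (𝓝 0) (𝓝 y) := by
      have hc : Continuous fun δ : ℝ => y + δ • (w + ε • (0 : E)) := by fun_prop
      simpa using hc.tendsto 0
    exact (hline.mono_left nhdsWithin_le_nhds).eventually hint
  · have hfr : y ∈ frontier {x | 0 ≤ h x} :=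
      ⟨subset_closure hy, fun hi => hint (mem_interior_iff_mem_nhds.1 hi)⟩
    obtain ⟨q, hq⟩ : ∃ q, 0 < fderiv ℝ h y q := by
      obtain ⟨q, hq⟩ := DFunLike.ne_iff.1 (hreg hfr)
      rcases lt_or_gt_of_ne hq with hneg | hpos
      · exact ⟨-q, by simpa using hneg⟩
      · exact ⟨q, by simpa using hpos⟩
    refine ⟨q, fun ε hε => eventually_nonneg_add_smul_of_fderiv_pos hd hy fun h0 => ?_⟩
    rw [map_add, map_smul, smul_eq_mul]
    exact add_pos_of_nonneg_of_pos (hw h0) (mul_pos hε hq)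

end Superlevel

/-! ### Variation of constants -/

section VariationOfConstants

variable {E : Type*} [NormedAddCommGroup E] [NormedSpace ℝ E] [CompleteSpace E]
  {A : E →L[ℝ] E} {y : ℝ → E} {a b : ℝ}

theorem continuous_exp_smul (A : E →L[ℝ] E) : Continuous fun t : ℝ => NormedSpace.exp (t • A) :=
  continuous_iff_continuousAt.2 fun t => (hasDerivAt_exp_smul_const A t).continuousAt

theorem hasDerivAt_exp_sub_smul (A : E →L[ℝ] E) (b s : ℝ) :
    HasDerivAt (fun r : ℝ => NormedSpace.exp ((b - r) • A))
      (-(NormedSpace.exp ((b - s) • A) * A)) s := by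
  rw [← neg_one_smul ℝ]
  exact (hasDerivAt_exp_smul_const A (b - s)).scomp s ((hasDerivAt_id' s).const_sub b)

theorem eq_exp_add_integral_of_isIntegralCurveOn {c : ℝ → E} (hab : a ≤ b)
    (hc : ContinuousOn c (Icc a b)) (hy : IsIntegralCurveOn y (fun s z => A z + c s) (Icc a b)) :
    y b = NormedSpace.exp ((b - a) • A) (y a) +
      ∫ s in a..b, NormedSpace.exp ((b - s) • A) (c s) := by
  have hexp : Continuous fun s => NormedSpace.exp ((b - s) • A) :=
    (continuous_exp_smul A).comp (by fun_prop)
  have hderiv : ∀ s ∈ Ioo a b, HasDerivAt (fun r => NormedSpace.exp ((b - r) • A) (y r))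
      (NormedSpace.exp ((b - s) • A) (c s)) s := by
    intro s hs
    have hys := (hy s (Ioo_subset_Icc_self hs)).hasDerivAt (Icc_mem_nhds hs.1 hs.2)
    simpa using (hasDerivAt_exp_sub_smul A b s).clm_apply hys
  have hint : IntervalIntegrable (fun s => NormedSpace.exp ((b - s) • A) (c s))
      MeasureTheory.volume a b :=
    (hexp.continuousOn.clm_apply hc).intervalIntegrable_of_Icc hab
  rw [intervalIntegral.integral_eq_sub_of_hasDerivAt_of_le hab
    (hexp.continuousOn.clm_apply hy.continuousOn) hderiv hint]
  simp

theorem tendsto_nhdsLT_of_isIntegralCurveOn {c : E} (hab : a < b)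
    (hy : IsIntegralCurveOn y (fun _ z => A z + c) (Ico a b)) :
    Tendsto y (𝓝[<] b) (𝓝 (NormedSpace.exp ((b - a) • A) (y a) +
      ∫ s in (0 : ℝ)..b - a, NormedSpace.exp (s • A) c)) := by
  have hexp (z : E) : Continuous fun s : ℝ => NormedSpace.exp (s • A) z :=
    (continuous_exp_smul A).clm_apply continuous_const
  have hcont : Continuous fun t : ℝ => NormedSpace.exp ((t - a) • A) (y a) +
      ∫ s in (0 : ℝ)..t - a, NormedSpace.exp (s • A) c :=
    ((hexp (y a)).add (intervalIntegral.continuous_primitive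
      (fun _ _ => (hexp c).intervalIntegrable _ _) 0)).comp (continuous_sub_right a)
  refine ((hcont.tendsto b).mono_left nhdsWithin_le_nhds).congr' ?_
  filter_upwards [Ioo_mem_nhdsLT hab] with t ht
  rw [eq_exp_add_integral_of_isIntegralCurveOn ht.1.le continuousOn_const
    (hy.mono (Icc_subset_Ico_right ht.2)),
    intervalIntegral.integral_comp_sub_left (fun s => NormedSpace.exp (s • A) c), sub_self]

end VariationOfConstants

/-! ### Pontryagin differences -/

section PontryaginDiff

variable {E F : Type*} {P Q : Set E} {s t : Set E} {x y : E}

theorem pontryaginDiff_mono [Add E] (h : P ⊆ Q) : pontryaginDiff P s ⊆ pontryaginDiff Q s :=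
  fun _ hx r hr => h (hx r hr)

theorem pontryaginDiff_singleton_zero [AddZeroClass E] : pontryaginDiff P {0} = P := by
  simp [pontryaginDiff]

theorem add_mem_pontryaginDiff [AddSemigroup E] (hx : x ∈ pontryaginDiff P t)
    (hy : ∀ r ∈ s, y + r ∈ t) : x + y ∈ pontryaginDiff P s :=
  fun r hr => by simpa only [add_assoc] using hx (y + r) (hy r hr)

theorem map_mem_pontryaginDiff_image [Add E] [Add F] {V : Set F}
    {M : Type*} [FunLike M E F] [AddHomClass M E F] (L : M) (hL : MapsTo L P V)
    (hx : x ∈ pontryaginDiff P s) : L x ∈ pontryaginDiff V (L '' s) := by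
  rintro _ ⟨r, hr, rfl⟩
  rw [← map_add]
  exact hL (hx r hr)

end PontryaginDiff

namespace MultiRate

variable {n d : ℕ} {S : MultiRate n d}

/-! ### Safety of the low level -/

section LowLevel

variable {z w : EuclideanSpace ℝ (Fin n) × EuclideanSpace ℝ (Fin n)}
  {πu : EuclideanSpace ℝ (Fin n) × EuclideanSpace ℝ (Fin n) → EuclideanSpace ℝ (Fin d) →
    EuclideanSpace ℝ (Fin d)}

theorem isClosed_safePairs (hhx : Continuous S.hx) (hhe : Continuous S.he) :
    IsClosed S.safePairs :=
  ((isClosed_le continuous_const hhx).preimage continuous_fst).inter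
    ((isClosed_le continuous_const hhe).preimage (continuous_fst.sub continuous_snd))

theorem mem_posTangentConeAt_safePairs
    (hhx : DifferentiableAt ℝ S.hx z.1) (hhe : DifferentiableAt ℝ S.he (z.1 - z.2))
    (hhx_reg : z.1 ∈ frontier S.Sx → fderiv ℝ S.hx z.1 ≠ 0)
    (hhe_reg : z.1 - z.2 ∈ frontier S.Se → fderiv ℝ S.he (z.1 - z.2) ≠ 0)
    (hz : z ∈ S.safePairs) (hwx : S.hx z.1 = 0 → 0 ≤ fderiv ℝ S.hx z.1 w.1)
    (hwe : S.he (z.1 - z.2) = 0 → 0 ≤ fderiv ℝ S.he (z.1 - z.2) (w.1 - w.2)) :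
    w ∈ posTangentConeAt S.safePairs z := by
  obtain ⟨q, hq⟩ := exists_forall_eventually_nonneg_add_smul hhx hz.1 hwx hhx_reg
  obtain ⟨r, hr⟩ := exists_forall_eventually_nonneg_add_smul hhe hz.2 hwe hhe_reg
  refine mem_posTangentConeAt_of_forall_perturbation (q, q - r) fun ε hε =>
    Eventually.frequently ?_
  filter_upwards [hq ε hε, hr ε hε] with δ hδx hδe
  have herr : z.1 - z.2 + δ • (w.1 - w.2 + ε • r) =
      z.1 + δ • (w.1 + ε • q) - (z.2 + δ • (w.2 + ε • (q - r))) := by module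
  rw [herr] at hδe
  exact ⟨hδx, hδe⟩

theorem lipschitzNear_augField
    {μ : EuclideanSpace ℝ (Fin n) × EuclideanSpace ℝ (Fin n) → EuclideanSpace ℝ (Fin d)}
    (hf : LipschitzNear S.f z.1) (hg : LipschitzNear S.g z.1) (hμ : LipschitzNear μ z)
    (v : EuclideanSpace ℝ (Fin d)) : LipschitzNear (fun y => S.augField y (μ y) v) z := by
  have hfst : LipschitzNear Prod.fst z := LipschitzWith.prod_fst.locallyLipschitz z
  have hsnd : LipschitzNear (fun y : EuclideanSpace ℝ (Fin n) × EuclideanSpace ℝ (Fin n) => S.A y.2)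
    z := (S.A.lipschitz.comp LipschitzWith.prod_snd).locallyLipschitz z
  have hconst {F : Type} [NormedAddCommGroup F] (c : F) : LipschitzNear (fun _ => c) z :=
    (LipschitzWith.const c).locallyLipschitz z
  exact ((hf.comp hfst).add ((hg.comp hfst).clm_apply (hμ.add (hconst v)))).prodMk
    (hsnd.add (hconst (S.B v)))

theorem QPFeasible.augField_mem_posTangentConeAt {u v : EuclideanSpace ℝ (Fin d)} {γ : ℝ}
    (h : S.QPFeasible z v u γ) (hα₁ : S.α₁ 0 ≤ 0) (hα₂ : S.α₂ 0 ≤ 0)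
    (hhx : DifferentiableAt ℝ S.hx z.1) (hhe : DifferentiableAt ℝ S.he (z.1 - z.2))
    (hhx_reg : z.1 ∈ frontier S.Sx → fderiv ℝ S.hx z.1 ≠ 0)
    (hhe_reg : z.1 - z.2 ∈ frontier S.Se → fderiv ℝ S.he (z.1 - z.2) ≠ 0)
    (hz : z ∈ S.safePairs) : S.augField z u v ∈ posTangentConeAt S.safePairs z := by
  refine mem_posTangentConeAt_safePairs hhx hhe hhx_reg hhe_reg hz (fun h0 => ?_) fun h0 => ?_
  · have hbarrier := h.state_barrier
    rw [h0] at hbarrier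
    exact (neg_nonneg.2 hα₁).trans hbarrier
  · have hchain : HasFDerivAt
        (fun y : EuclideanSpace ℝ (Fin n) × EuclideanSpace ℝ (Fin n) => S.he (y.1 - y.2)) _ z :=
      hhe.hasFDerivAt.comp z (hasFDerivAt_fst.sub hasFDerivAt_snd)
    have hbarrier := h.error_barrier
    rw [h0, hchain.fderiv] at hbarrier
    exact (neg_nonneg.2 hα₂).trans hbarrier

variable (S) in
/-- A low level policy that, for constant admissible high level inputs, is continuous and admissible
on the set of safe pairs and renders it forward invariant for the flow. -/
structure IsSafeLowLevelPolicy
    (πu : EuclideanSpace ℝ (Fin n) × EuclideanSpace ℝ (Fin n) → EuclideanSpace ℝ (Fin d) →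
      EuclideanSpace ℝ (Fin d)) : Prop where
  continuousAt : ∀ v ∈ S.V, ∀ z ∈ S.safePairs, ContinuousAt (fun y => πu y v) z
  input_mem : ∀ v ∈ S.V, ∀ z ∈ S.safePairs, πu z v ∈ S.U
  mapsTo : ∀ v ∈ S.V, ∀ (z : ℝ → EuclideanSpace ℝ (Fin n) × EuclideanSpace ℝ (Fin n)) (a b : ℝ),
    ContinuousWithinAt z (Ioi a) a →
    (∀ t ∈ Ioo a b, HasDerivAt z (S.augField (z t) (πu (z t) v) v) t) →
    z a ∈ S.safePairs → MapsTo z (Ico a b) S.safePairs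

theorem isSafeLowLevelPolicy_of_qpFeasible (hα₁ : S.α₁ 0 ≤ 0) (hα₂ : S.α₂ 0 ≤ 0)
    (hf : ∀ x ∈ S.Sx, LipschitzNear S.f x) (hg : ∀ x ∈ S.Sx, LipschitzNear S.g x)
    (hhx : Differentiable ℝ S.hx) (hhe : Differentiable ℝ S.he)
    (hhx_reg : ∀ x ∈ frontier S.Sx, fderiv ℝ S.hx x ≠ 0)
    (hhe_reg : ∀ e ∈ frontier S.Se, fderiv ℝ S.he e ≠ 0)
    (hπu : ∀ v ∈ S.V, ∀ z ∈ S.safePairs, ∃ γ, S.QPFeasible z v (πu z v) γ)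
    (hπu_lip : ∀ v ∈ S.V, ∀ z ∈ S.safePairs, LipschitzNear (fun y => πu y v) z) :
    S.IsSafeLowLevelPolicy πu where
  continuousAt v hv z hz := (hπu_lip v hv z hz).continuousAt
  input_mem v hv z hz := (hπu v hv z hz).elim fun _ h => h.input
  mapsTo v hv z a b hcont hderiv hza t ht := by
    have hlip : ∀ y ∈ S.safePairs, LipschitzNear (fun y => S.augField y (πu y v) v) y :=
      fun y hy => lipschitzNear_augField (hf _ hy.1) (hg _ hy.1) (hπu_lip v hv y hy) v
    have htan : ∀ y ∈ S.safePairs, S.augField y (πu y v) v ∈ posTangentConeAt S.safePairs y :=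
      fun y hy => (hπu v hv y hy).elim fun _ h => h.augField_mem_posTangentConeAt hα₁ hα₂
        (hhx _) (hhe _) (hhx_reg _) (hhe_reg _) hy
    have hcurve : IsIntegralCurveOn z (fun _ y => S.augField y (πu y v) v) (Icc a t) :=
      (isIntegralCurveOn_Ico_of_continuousWithinAt hcont (hlip _ hza).continuousAt hderiv).mono
        (Icc_subset_Ico_right ht.2)
    exact mapsTo_of_mem_posTangentConeAt (isClosed_safePairs hhx.continuous hhe.continuous)
      hlip htan hcurve hza (right_mem_Icc.2 ht.1)

end LowLevel

/-! ### Recursive feasibility of the high level -/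

section HighLevel

variable {x₀ w : EuclideanSpace ℝ (Fin n)} {xs : ℕ → EuclideanSpace ℝ (Fin n)}
  {vs : ℕ → EuclideanSpace ℝ (Fin d)}

variable (S) in
/-- The same data with prediction horizon `m`; prolonging and truncating predictions changes the
horizon by one. -/
def withHorizon (m : ℕ) : MultiRate n d := { S with N := m }

theorem withHorizon_tube (m : ℕ) : ∀ j, (S.withHorizon m).tube j = S.tube j
  | 0 => rfl
  | j + 1 => congrArg (fun t => S.Acl '' t + S.W) (withHorizon_tube m j)

theorem ocpFeasible_withHorizon_iff {m : ℕ} :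
    (S.withHorizon m).OCPFeasible x₀ xs vs ↔
      xs 0 = x₀ ∧ (∀ j < m, xs (j + 1) = S.Acl (xs j) + S.D (S.Bbar (vs j))) ∧
      (∀ j ≤ m, xs j ∈ pontryaginDiff (S.Xd ∩ S.Sx) (S.tube j)) ∧
      (∀ j ≤ m, vs j + S.K (xs j) ∈ pontryaginDiff S.V (S.K '' S.tube j)) ∧
      xs m ∈ pontryaginDiff S.XF (S.tube m) := by
  rw [← funext (withHorizon_tube m)]
  exact ⟨fun h => ⟨h.init, h.dyn, h.state, h.input, h.terminal⟩,
    fun ⟨h₀, h₁, h₂, h₃, h₄⟩ => ⟨h₀, h₁, h₂, h₃, h₄⟩⟩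

variable (S) in
/-- The initial states for which the finite time optimal control problem is feasible. -/
def feasibleStates : Set (EuclideanSpace ℝ (Fin n)) :=
  {x₀ | ∃ xs vs, S.OCPFeasible x₀ xs vs}

theorem iterate_Acl_add_mem_tube_succ (hw : w ∈ S.W) :
    ∀ j, ∀ s ∈ S.tube j, (S.Acl ^ j) w + s ∈ S.tube (j + 1)
  | 0, _, rfl => ⟨0, ⟨0, rfl, map_zero _⟩, w, hw, by simp⟩
  | j + 1, _, ⟨_, ⟨s, hs, rfl⟩, w', hw', rfl⟩ => by
    refine ⟨_, ⟨_, iterate_Acl_add_mem_tube_succ hw j s hs, rfl⟩, w', hw', ?_⟩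
    simp only [map_add, pow_succ', mul_apply_eq_comp, add_assoc]

theorem IsRobustPosInvariant.Acl_mem_pontryaginDiff_tube_succ
    {X : Set (EuclideanSpace ℝ (Fin n))} (hX : S.IsRobustPosInvariant X) {j : ℕ}
    {x : EuclideanSpace ℝ (Fin n)} (hx : x ∈ pontryaginDiff X (S.tube j)) :
    S.Acl x ∈ pontryaginDiff X (S.tube (j + 1)) := by
  rintro _ ⟨_, ⟨s, hs, rfl⟩, w, hw, rfl⟩
  rw [← add_assoc, ← map_add]
  exact hX _ (hx s hs) w hw

theorem OCPFeasible.state_mem (h : S.OCPFeasible x₀ xs vs) : x₀ ∈ S.Xd ∩ S.Sx := by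
  rw [← h.init, ← pontryaginDiff_singleton_zero (P := S.Xd ∩ S.Sx)]
  exact h.state 0 (Nat.zero_le _)

theorem feasibleStates_subset : S.feasibleStates ⊆ S.Xd ∩ S.Sx := by
  rintro x₀ ⟨xs, vs, h⟩
  exact h.state_mem

theorem OCPFeasible.input_mem (h : S.OCPFeasible x₀ xs vs) : vs 0 + S.K (xs 0) ∈ S.V := by
  have hinput := h.input 0 (Nat.zero_le _)
  rwa [tube, image_singleton, map_zero, pontryaginDiff_singleton_zero] at hinput

theorem OCPFeasible.exists_prolongation (h : S.OCPFeasible x₀ xs vs) (hXF : S.XF ⊆ S.Xd ∩ S.Sx)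
    (hXF_input : MapsTo S.K S.XF S.V) (hXF_inv : S.IsRobustPosInvariant S.XF) :
    ∃ xs' vs', (S.withHorizon (S.N + 1)).OCPFeasible x₀ xs' vs' ∧ ∀ j < S.N, vs' j = vs j := by
  let xs' : ℕ → EuclideanSpace ℝ (Fin n) := fun j => if j ≤ S.N then xs j else S.Acl (xs S.N)
  let vs' : ℕ → EuclideanSpace ℝ (Fin d) := fun j => if j < S.N then vs j else 0
  have hxs' : ∀ j ≤ S.N, xs' j = xs j := fun j hj => if_pos hj
  have hxs'_last : xs' (S.N + 1) = S.Acl (xs S.N) := if_neg (Nat.lt_irrefl _)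
  have hvs' : ∀ j < S.N, vs' j = vs j := fun j hj => if_pos hj
  have hvs'_zero : ∀ j ≥ S.N, vs' j = 0 := fun j hj => if_neg hj.not_gt
  have hterminal : ∀ j ≥ S.N, j ≤ S.N + 1 → xs' j ∈ pontryaginDiff S.XF (S.tube j) := by
    intro j hNj hj
    obtain rfl | rfl : j = S.N ∨ j = S.N + 1 := by omega
    · exact hxs' _ le_rfl ▸ h.terminal
    · exact hxs'_last ▸ hXF_inv.Acl_mem_pontryaginDiff_tube_succ h.terminal
  refine ⟨xs', vs', ocpFeasible_withHorizon_iff.2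
    ⟨?_, fun j hj => ?_, fun j hj => ?_, fun j hj => ?_, ?_⟩, hvs'⟩
  · exact (hxs' 0 (Nat.zero_le _)).trans h.init
  · rcases (Nat.lt_succ_iff.1 hj).lt_or_eq with hjN | rfl
    · rw [hxs' _ hjN, hxs' _ hjN.le, hvs' _ hjN, h.dyn j hjN]
    · rw [hxs'_last, hxs' _ le_rfl, hvs'_zero _ le_rfl, map_zero, map_zero, add_zero]
  · rcases le_total j S.N with hjN | hjN
    · exact hxs' j hjN ▸ h.state j hjN
    · exact pontryaginDiff_mono hXF (hterminal j hjN hj)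
  · rcases lt_or_ge j S.N with hjN | hjN
    · exact hxs' j hjN.le ▸ hvs' j hjN ▸ h.input j hjN.le
    · rw [hvs'_zero j hjN, zero_add]
      exact map_mem_pontryaginDiff_image S.K hXF_input (hterminal j hjN hj)
  · exact hterminal (S.N + 1) (Nat.le_succ _) le_rfl

theorem OCPFeasible.shift (h : (S.withHorizon (S.N + 1)).OCPFeasible x₀ xs vs) (hw : w ∈ S.W) :
    S.OCPFeasible (xs 1 + w) (fun j => xs (j + 1) + (S.Acl ^ j) w) (fun j => vs (j + 1)) := by
  obtain ⟨-, hdyn, hstate, hinput, hterminal⟩ := ocpFeasible_withHorizon_iff.1 h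
  refine ⟨rfl, fun j hj => ?_, fun j hj => ?_, fun j hj => ?_, ?_⟩
  · rw [hdyn (j + 1) (Nat.succ_lt_succ hj), map_add, pow_succ', mul_apply_eq_comp, add_right_comm]
  · exact add_mem_pontryaginDiff (hstate (j + 1) (Nat.succ_le_succ hj))
      (iterate_Acl_add_mem_tube_succ hw j)
  · rw [map_add, ← add_assoc]
    refine add_mem_pontryaginDiff (hinput (j + 1) (Nat.succ_le_succ hj)) ?_
    rintro _ ⟨s, hs, rfl⟩
    exact ⟨_, iterate_Acl_add_mem_tube_succ hw j s hs, map_add ..⟩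
  · exact add_mem_pontryaginDiff hterminal (iterate_Acl_add_mem_tube_succ hw S.N)

theorem OCPFeasible.successor_mem_feasibleStates (h : S.OCPFeasible x₀ xs vs) (hN : 1 ≤ S.N)
    (hXF : S.XF ⊆ S.Xd ∩ S.Sx) (hXF_input : MapsTo S.K S.XF S.V)
    (hXF_inv : S.IsRobustPosInvariant S.XF) (hw : w ∈ S.W) :
    S.Acl x₀ + S.D (S.Bbar (vs 0)) + w ∈ S.feasibleStates := by
  obtain ⟨xs', vs', h', hvs'⟩ := h.exists_prolongation hXF hXF_input hXF_inv
  have hxs' : xs' 1 = S.Acl (xs' 0) + S.D (S.Bbar (vs' 0)) := h'.dyn 0 (Nat.succ_pos _)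
  rw [← hvs' 0 hN, ← h'.init, ← hxs']
  exact ⟨_, _, h'.shift hw⟩

variable (S) in
/-- A high level policy that, on the feasible states, is admissible and keeps the sampled closed
loop feasible against every disturbance in `S.W`. -/
structure IsRecursivelyFeasiblePolicy
    (πv : EuclideanSpace ℝ (Fin n) → EuclideanSpace ℝ (Fin d)) : Prop where
  input_mem : ∀ x₀ ∈ S.feasibleStates, πv x₀ ∈ S.V
  successor_mem : ∀ x₀ ∈ S.feasibleStates, ∀ w ∈ S.W,
    S.D (S.Abar x₀ + S.Bbar (πv x₀)) + w ∈ S.feasibleStates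

theorem isRecursivelyFeasiblePolicy_of_ocpFeasible
    {πv : EuclideanSpace ℝ (Fin n) → EuclideanSpace ℝ (Fin d)} (hN : 1 ≤ S.N)
    (hXF : S.XF ⊆ S.Xd ∩ S.Sx) (hXF_input : MapsTo S.K S.XF S.V)
    (hXF_inv : S.IsRobustPosInvariant S.XF)
    (hπv : ∀ x₀ ∈ S.feasibleStates,
      ∃ xs vs, S.OCPFeasible x₀ xs vs ∧ πv x₀ = vs 0 + S.K (xs 0)) :
    S.IsRecursivelyFeasiblePolicy πv where
  input_mem x₀ hx₀ := by
    obtain ⟨xs, vs, h, heq⟩ := hπv x₀ hx₀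
    exact heq ▸ h.input_mem
  successor_mem x₀ hx₀ w hw := by
    obtain ⟨xs, vs, h, heq⟩ := hπv x₀ hx₀
    have hstep : S.D (S.Abar x₀ + S.Bbar (πv x₀)) = S.Acl x₀ + S.D (S.Bbar (vs 0)) := by
      simp only [heq, h.init, Acl, ContinuousLinearMap.comp_apply, add_apply, map_add]
      abel
    rw [hstep]
    exact h.successor_mem_feasibleStates hN hXF hXF_input hXF_inv hw

end HighLevel

/-! ### The closed loop -/

section ClosedLoop

variable {πu : EuclideanSpace ℝ (Fin n) × EuclideanSpace ℝ (Fin n) → EuclideanSpace ℝ (Fin d) →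
    EuclideanSpace ℝ (Fin d)}
  {πv : EuclideanSpace ℝ (Fin n) → EuclideanSpace ℝ (Fin d)} {τ : EReal}
  {x xb : ℝ → EuclideanSpace ℝ (Fin n)} {u v : ℝ → EuclideanSpace ℝ (Fin d)} {k : ℕ} {t : ℝ}

theorem Abar_add_Bbar_apply (y : EuclideanSpace ℝ (Fin n)) (w : EuclideanSpace ℝ (Fin d)) :
    S.Abar y + S.Bbar w = NormedSpace.exp (S.T • S.A) y +
      ∫ s in (0 : ℝ)..S.T, NormedSpace.exp (s • S.A) (S.B w) := by
  have hexp : Continuous fun s : ℝ => (NormedSpace.exp ((S.T - s) • S.A)).comp S.B :=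
    ((continuous_exp_smul S.A).comp (continuous_sub_left S.T)).clm_comp continuous_const
  have hreflect := intervalIntegral.integral_comp_sub_left (a := 0) (b := S.T)
    (fun s => NormedSpace.exp (s • S.A) (S.B w)) S.T
  rw [sub_self, sub_zero] at hreflect
  rw [Abar, Bbar, ContinuousLinearMap.intervalIntegral_apply (hexp.intervalIntegrable _ _),
    ← hreflect]
  rfl

theorem exists_mem_period (hT : 0 < S.T) (ht : 0 ≤ t) :
    ∃ k : ℕ, k * S.T ≤ t ∧ t < (k + 1) * S.T :=
  ⟨⌊t / S.T⌋₊, (le_div_iff₀ hT).1 (Nat.floor_le (div_nonneg ht hT.le)),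
    (div_lt_iff₀ hT).1 (Nat.lt_floor_add_one _)⟩

namespace IsClosedLoop

theorem xb_transition (hcl : S.IsClosedLoop πu πv τ x xb u v)
    (hk : ((k * S.T : ℝ) : EReal) < τ) : xb (k * S.T) = x (k * S.T) := by
  rcases Nat.eq_zero_or_pos k with rfl | hpos
  · simpa using hcl.init_xb
  · obtain ⟨xm, -, hx, hxb⟩ := hcl.jump k hpos hk
    exact hxb.trans hx.symm

theorem u_eq (hcl : S.IsClosedLoop πu πv τ x xb u v) (hkt : k * S.T < t)
    (htk : t < (k + 1) * S.T) (htτ : (t : EReal) < τ) :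
    u t = πu (x t, xb t) (πv (x (k * S.T))) := by
  rw [hcl.low k t hkt htk htτ, hcl.high k t hkt.le htk htτ]

theorem hasDerivAt (hcl : S.IsClosedLoop πu πv τ x xb u v) (hkt : k * S.T < t)
    (htk : t < (k + 1) * S.T) (htτ : (t : EReal) < τ) :
    HasDerivAt (fun s => (x s, xb s)) (S.augField (x t, xb t)
      (πu (x t, xb t) (πv (x (k * S.T)))) (πv (x (k * S.T)))) t := by
  have hflow := hcl.flow k t hkt htk htτ
  rwa [hcl.u_eq hkt htk htτ, hcl.high k t hkt.le htk htτ] at hflow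

theorem mem_safePairs (hcl : S.IsClosedLoop πu πv τ x xb u v) (hlow : S.IsSafeLowLevelPolicy πu)
    (hSe : 0 ∈ S.Se) (hx : x (k * S.T) ∈ S.Sx) (hv : πv (x (k * S.T)) ∈ S.V)
    (hkt : k * S.T ≤ t) (htk : t < (k + 1) * S.T) (htτ : (t : EReal) < τ) :
    (x t, xb t) ∈ S.safePairs := by
  have hkτ : ((k * S.T : ℝ) : EReal) < τ := (EReal.coe_le_coe_iff.2 hkt).trans_lt htτ
  obtain ⟨c, htc, hcτ⟩ := EReal.lt_iff_exists_real_btwn.1 htτ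
  have hstart : (x (k * S.T), xb (k * S.T)) ∈ S.safePairs :=
    ⟨hx, by rwa [hcl.xb_transition hkτ, sub_self]⟩
  refine hlow.mapsTo _ hv (fun s => (x s, xb s)) (k * S.T) (min c ((k + 1) * S.T))
    ((hcl.right_x k hkτ).prodMk_nhds (hcl.right_xb k hkτ)) (fun s hs => ?_) hstart
    ⟨hkt, lt_min (EReal.coe_lt_coe_iff.1 htc) htk⟩
  obtain ⟨hsc, hsk⟩ := lt_min_iff.1 hs.2
  exact hcl.hasDerivAt hs.1 hsk ((EReal.coe_lt_coe_iff.2 hsc).trans hcτ)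

theorem tendsto_xb (hcl : S.IsClosedLoop πu πv τ x xb u v) (hT : 0 < S.T)
    (hτ : (((k + 1) * S.T : ℝ) : EReal) < τ) :
    Tendsto xb (𝓝[<] ((k + 1) * S.T))
      (𝓝 (S.Abar (x (k * S.T)) + S.Bbar (πv (x (k * S.T))))) := by
  have hlt : (k : ℝ) * S.T < (k + 1) * S.T := mul_lt_mul_of_pos_right (lt_add_one _) hT
  have hkτ : ((k * S.T : ℝ) : EReal) < τ := (EReal.coe_lt_coe_iff.2 hlt).trans hτ
  have hcurve : IsIntegralCurveOn xb (fun _ y => S.A y + S.B (πv (x (k * S.T))))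
      (Ico (k * S.T) ((k + 1) * S.T)) :=
    isIntegralCurveOn_Ico_of_continuousWithinAt (hcl.right_xb k hkτ) (by fun_prop) fun s hs =>
      (hcl.hasDerivAt hs.1 hs.2 ((EReal.coe_lt_coe_iff.2 hs.2).trans hτ)).snd
  have hperiod : (k + 1) * S.T - k * S.T = S.T := by ring
  have hlim := tendsto_nhdsLT_of_isIntegralCurveOn hlt hcurve
  rwa [hperiod, hcl.xb_transition hkτ, ← Abar_add_Bbar_apply] at hlim

/-- The disturbance is the reset of the tracking error at the end of the period: `S.reset` is
affine, so `Δ(x⁻) = D x̄⁻ + Δ(x⁻ - x̄⁻)`. -/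
theorem exists_transition (hcl : S.IsClosedLoop πu πv τ x xb u v)
    (hlow : S.IsSafeLowLevelPolicy πu) (hT : 0 < S.T) (hclosed : IsClosed S.safePairs)
    (hSe : 0 ∈ S.Se) (hSeBar : S.Se ⊆ S.SeBar) (hx : x (k * S.T) ∈ S.Sx)
    (hv : πv (x (k * S.T)) ∈ S.V) (hτ : (((k + 1) * S.T : ℝ) : EReal) < τ) :
    ∃ z ∈ S.safePairs, Tendsto (fun t => (x t, xb t)) (𝓝[<] ((k + 1) * S.T)) (𝓝 z) ∧
      ∃ w ∈ S.W, x ((k + 1) * S.T) =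
        S.D (S.Abar (x (k * S.T)) + S.Bbar (πv (x (k * S.T)))) + w := by
  obtain ⟨xm, hxm, hjump, -⟩ := hcl.jump (k + 1) (Nat.le_add_left 1 k) (by rwa [Nat.cast_succ])
  rw [Nat.cast_succ] at hxm hjump
  have hlim := hxm.prodMk_nhds (hcl.tendsto_xb hT hτ)
  have hmem : (xm, S.Abar (x (k * S.T)) + S.Bbar (πv (x (k * S.T)))) ∈ S.safePairs := by
    have hlt : (k : ℝ) * S.T < (k + 1) * S.T := mul_lt_mul_of_pos_right (lt_add_one _) hT
    refine hclosed.mem_of_tendsto hlim ?_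
    filter_upwards [Ioo_mem_nhdsLT hlt] with t ht
    exact hcl.mem_safePairs hlow hSe hx hv ht.1.le ht.2
      ((EReal.coe_lt_coe_iff.2 ht.2).trans hτ)
  refine ⟨_, hmem, hlim, _, ⟨_, hSeBar hmem.2, rfl⟩, ?_⟩
  rw [hjump, reset, reset, ← add_assoc, ← map_add, add_sub_cancel]

theorem u_transition_mem (hcl : S.IsClosedLoop πu πv τ x xb u v)
    (hlow : S.IsSafeLowLevelPolicy πu) (hT : 0 < S.T) (hclosed : IsClosed S.safePairs)
    (hSe : 0 ∈ S.Se) (hSeBar : S.Se ⊆ S.SeBar) (hx : x (k * S.T) ∈ S.Sx)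
    (hv : πv (x (k * S.T)) ∈ S.V) (hτ : (((k + 1) * S.T : ℝ) : EReal) < τ) :
    u ((k + 1) * S.T) ∈ S.U := by
  obtain ⟨z, hz, hlim, -⟩ := hcl.exists_transition hlow hT hclosed hSe hSeBar hx hv hτ
  have hu : Tendsto u (𝓝[<] ((k + 1) * S.T)) (𝓝 (πu z (πv (x (k * S.T))))) := by
    have hlt : (k : ℝ) * S.T < (k + 1) * S.T := mul_lt_mul_of_pos_right (lt_add_one _) hT
    refine ((hlow.continuousAt _ hv z hz).tendsto.comp hlim).congr' ?_
    filter_upwards [Ioo_mem_nhdsLT hlt] with t ht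
    exact (hcl.u_eq ht.1 ht.2 ((EReal.coe_lt_coe_iff.2 ht.2).trans hτ)).symm
  have hjump := hcl.jump_u (k + 1) (Nat.le_add_left 1 k) (by rwa [Nat.cast_succ])
  rw [Nat.cast_succ] at hjump
  rw [tendsto_nhds_unique hjump hu]
  exact hlow.input_mem _ hv z hz

theorem mem_feasibleStates (hcl : S.IsClosedLoop πu πv τ x xb u v)
    (hlow : S.IsSafeLowLevelPolicy πu) (hhigh : S.IsRecursivelyFeasiblePolicy πv) (hT : 0 < S.T)
    (hclosed : IsClosed S.safePairs) (hSe : 0 ∈ S.Se) (hSeBar : S.Se ⊆ S.SeBar)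
    (hx₀ : x 0 ∈ S.feasibleStates) :
    ∀ k : ℕ, ((k * S.T : ℝ) : EReal) < τ → x (k * S.T) ∈ S.feasibleStates
  | 0, _ => by rwa [Nat.cast_zero, zero_mul]
  | k + 1, hτ => by
    rw [Nat.cast_succ] at hτ ⊢
    have hle : (k : ℝ) * S.T ≤ (k + 1) * S.T := mul_le_mul_of_nonneg_right (by simp) hT.le
    have hk : x (k * S.T) ∈ S.feasibleStates :=
      mem_feasibleStates hcl hlow hhigh hT hclosed hSe hSeBar hx₀ k
        ((EReal.coe_le_coe_iff.2 hle).trans_lt hτ)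
    obtain ⟨-, -, -, w, hw, hx⟩ := hcl.exists_transition hlow hT hclosed hSe hSeBar
      (feasibleStates_subset hk).2 (hhigh.input_mem _ hk) hτ
    exact hx ▸ hhigh.successor_mem _ hk w hw

theorem u_mem (hcl : S.IsClosedLoop πu πv τ x xb u v)
    (hlow : S.IsSafeLowLevelPolicy πu) (hT : 0 < S.T) (hclosed : IsClosed S.safePairs)
    (hSe : 0 ∈ S.Se) (hSeBar : S.Se ⊆ S.SeBar)
    (hx : ∀ k : ℕ, ((k * S.T : ℝ) : EReal) < τ → x (k * S.T) ∈ S.Sx)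
    (hv : ∀ k : ℕ, ((k * S.T : ℝ) : EReal) < τ → πv (x (k * S.T)) ∈ S.V)
    (ht : 0 ≤ t) (htτ : (t : EReal) < τ) : u t ∈ S.U := by
  obtain ⟨k, hkt, htk⟩ := exists_mem_period hT ht
  have hkτ : ((k * S.T : ℝ) : EReal) < τ := (EReal.coe_le_coe_iff.2 hkt).trans_lt htτ
  have hpolicy : πu (x t, xb t) (v t) ∈ S.U := by
    rw [hcl.high k t hkt htk htτ]
    exact hlow.input_mem _ (hv k hkτ) _
      (hcl.mem_safePairs hlow hSe (hx k hkτ) (hv k hkτ) hkt htk htτ)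
  rcases hkt.lt_or_eq with hlt | rfl
  · rwa [hcl.low k t hlt htk htτ]
  rcases k with _ | k
  · rw [Nat.cast_zero, zero_mul] at hpolicy ⊢
    rwa [hcl.init_u]
  · rw [Nat.cast_succ] at htτ ⊢
    have hle : (k : ℝ) * S.T ≤ (k + 1) * S.T := mul_le_mul_of_nonneg_right (by simp) hT.le
    have hkτ' : ((k * S.T : ℝ) : EReal) < τ := (EReal.coe_le_coe_iff.2 hle).trans_lt htτ
    exact hcl.u_transition_mem hlow hT hclosed hSe hSeBar (hx k hkτ') (hv k hkτ') htτ

end IsClosedLoop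

end ClosedLoop

end MultiRate

theorem theorem2_general {n d : ℕ} (S : MultiRate n d) (hT : 0 < S.T) (hN : 1 ≤ S.N)
    (hα₁ : S.α₁ 0 ≤ 0) (hα₂ : S.α₂ 0 ≤ 0)
    (hf : ∀ x ∈ S.Sx, LipschitzNear S.f x) (hg : ∀ x ∈ S.Sx, LipschitzNear S.g x)
    (hhx : Differentiable ℝ S.hx) (hhe : Differentiable ℝ S.he)
    (hhx_reg : ∀ x ∈ frontier S.Sx, fderiv ℝ S.hx x ≠ 0)
    (hhe_reg : ∀ e ∈ frontier S.Se, fderiv ℝ S.he e ≠ 0)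
    (hSx : S.Sx ⊆ S.Xc) (hSe : 0 ∈ S.Se) (hSeBar : S.Se ⊆ S.SeBar)
    (hXF : S.XF ⊆ S.Xd ∩ S.Sx) (hXF_input : MapsTo S.K S.XF S.V)
    (hXF_inv : S.IsRobustPosInvariant S.XF)
    (πu : EuclideanSpace ℝ (Fin n) × EuclideanSpace ℝ (Fin n) → EuclideanSpace ℝ (Fin d) →
      EuclideanSpace ℝ (Fin d))
    (πv : EuclideanSpace ℝ (Fin n) → EuclideanSpace ℝ (Fin d))
    (hπu : ∀ v ∈ S.V, ∀ z ∈ S.safePairs, ∃ γ, S.QPFeasible z v (πu z v) γ)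
    (hπv : ∀ x₀ ∈ S.feasibleStates, ∃ xs vs, S.OCPFeasible x₀ xs vs ∧ πv x₀ = vs 0 + S.K (xs 0))
    (hπu_lip : ∀ v ∈ S.V, ∀ z ∈ S.safePairs, LipschitzNear (fun y => πu y v) z)
    (τ : EReal) (x xb : ℝ → EuclideanSpace ℝ (Fin n)) (u v : ℝ → EuclideanSpace ℝ (Fin d))
    (hcl : S.IsClosedLoop πu πv τ x xb u v) (hfeas : x 0 ∈ S.feasibleStates) :
    (∀ (k : ℕ) (t : ℝ), k * S.T < t → t < (k + 1) * S.T → (t : EReal) < τ → x t ∈ S.Xc) ∧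
    (∀ k : ℕ, ((k * S.T : ℝ) : EReal) < τ → x (k * S.T) ∈ S.Xd) ∧
    (∀ t : ℝ, 0 ≤ t → (t : EReal) < τ → u t ∈ S.U ∧ v t ∈ S.V) := by
  have hclosed : IsClosed S.safePairs :=
    MultiRate.isClosed_safePairs hhx.continuous hhe.continuous
  have hlow : S.IsSafeLowLevelPolicy πu :=
    MultiRate.isSafeLowLevelPolicy_of_qpFeasible hα₁ hα₂ hf hg hhx hhe hhx_reg hhe_reg hπu hπu_lip
  have hhigh : S.IsRecursivelyFeasiblePolicy πv :=
    MultiRate.isRecursivelyFeasiblePolicy_of_ocpFeasible hN hXF hXF_input hXF_inv hπv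
  have hfeas_all := hcl.mem_feasibleStates hlow hhigh hT hclosed hSe hSeBar hfeas
  have hx : ∀ k : ℕ, ((k * S.T : ℝ) : EReal) < τ → x (k * S.T) ∈ S.Xd ∩ S.Sx :=
    fun k hkτ => MultiRate.feasibleStates_subset (hfeas_all k hkτ)
  have hv : ∀ k : ℕ, ((k * S.T : ℝ) : EReal) < τ → πv (x (k * S.T)) ∈ S.V :=
    fun k hkτ => hhigh.input_mem _ (hfeas_all k hkτ)
  refine ⟨fun k t hkt htk htτ => ?_, fun k hkτ => (hx k hkτ).1, fun t ht htτ =>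
    ⟨hcl.u_mem hlow hT hclosed hSe hSeBar (fun k hkτ => (hx k hkτ).2) hv ht htτ, ?_⟩⟩
  · have hkτ : ((k * S.T : ℝ) : EReal) < τ := (EReal.coe_lt_coe_iff.2 hkt).trans htτ
    exact hSx (hcl.mem_safePairs hlow hSe (hx k hkτ).2 (hv k hkτ) hkt.le htk htτ).1
  · obtain ⟨k, hkt, htk⟩ := MultiRate.exists_mem_period hT ht
    rw [hcl.high k t hkt htk htτ]
    exact hv k ((EReal.coe_le_coe_iff.2 hkt).trans_lt htτ)

theorem theorem2 {n d : ℕ} (S : MultiRate n d)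
    -- period, horizon and weights
    (hT : 0 < S.T) (hN : 1 ≤ S.N) (hc₁ : 0 < S.c₁) (hc₂ : 0 < S.c₂)
    (hα₁ : IsExtendedClassK S.α₁) (hα₂ : IsExtendedClassK S.α₂)
    -- regularity of the plant and of the barrier functions
    (hf : LocallyLipschitz S.f) (hg : LocallyLipschitz S.g)
    (hhx : ContDiff ℝ 1 S.hx) (hhe : ContDiff ℝ 1 S.he)
    (hhx_reg : ∀ x ∈ frontier S.Sx, fderiv ℝ S.hx x ≠ 0)
    (hhe_reg : ∀ e ∈ frontier S.Se, fderiv ℝ S.he e ≠ 0)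
    -- relations between the sets
    (hSx : S.Sx ⊆ S.Xc) (hXd : S.Xd ⊆ S.Xc)
    (hSe : 0 ∈ S.Se) (hSeBar : S.Se ⊆ S.SeBar)
    -- feasibility of the quadratic program
    (hQP : ∀ z ∈ S.safePairs, ∀ v ∈ S.V, ∃ u γ, S.QPFeasible z v u γ)
    -- the terminal set is admissible and robust positively invariant
    (hXF : S.XF ⊆ S.Xd ∩ S.Sx) (hXF_input : ∀ x ∈ S.XF, S.K x ∈ S.V)
    (hXF_inv : S.IsRobustPosInvariant S.XF)
    -- the policies
    (πu : EuclideanSpace ℝ (Fin n) × EuclideanSpace ℝ (Fin n) → EuclideanSpace ℝ (Fin d) →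
      EuclideanSpace ℝ (Fin d))
    (πv : EuclideanSpace ℝ (Fin n) → EuclideanSpace ℝ (Fin d))
    (hπu : S.IsLowLevelPolicy πu) (hπv : S.IsHighLevelPolicy πv)
    (hπu_lip : ∀ v ∈ S.V, ∀ z ∈ S.safePairs,
      ∃ (L : NNReal), ∃ s ∈ 𝓝 z, LipschitzOnWith L (fun y => πu y v) s)
    -- a closed-loop trajectory on `[0, τ)`, with `τ` possibly infinite
    (τ : EReal) (x xb : ℝ → EuclideanSpace ℝ (Fin n)) (u v : ℝ → EuclideanSpace ℝ (Fin d))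
    (hcl : S.IsClosedLoop πu πv τ x xb u v)
    -- feasibility at the initial time
    (hfeas : ∃ xs vs, S.OCPFeasible (x 0) xs vs) :
    (∀ (k : ℕ) (t : ℝ), k * S.T < t → t < (k + 1) * S.T → (t : EReal) < τ → x t ∈ S.Xc) ∧
    (∀ k : ℕ, ((k * S.T : ℝ) : EReal) < τ → x (k * S.T) ∈ S.Xd) ∧
    (∀ t : ℝ, 0 ≤ t → (t : EReal) < τ → u t ∈ S.U ∧ v t ∈ S.V) :=
  theorem2_general S hT hN hα₁.map_zero.le hα₂.map_zero.le (fun y _ => hf y) (fun y _ => hg y)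
    (hhx.differentiable one_ne_zero) (hhe.differentiable one_ne_zero) hhx_reg hhe_reg hSx hSe hSeBar
    hXF hXF_input hXF_inv πu πv
    (fun w hw z hz => (hπu z w (hQP z hz w hw)).imp fun _ hopt => hopt.1)
    (fun x₀ hx₀ => (hπv x₀ hx₀).imp fun _ => Exists.imp fun _ hopt => hopt.imp_left And.left)
    hπu_lip τ x xb u v hcl hfeas
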